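/- **Setting.** Work in synthetic differential geometry. Let $\mathcal E=\mathrm{Sh}(\mathcal C,J)$ be the topos of sheaves on a site, and let $R$ be a commutative $\mathbb Q$-algebra object in $\mathcal E$ satisfying the Kock–Lawvere axiom: for every Weil algebra $W$ over $\mathbb Q$ (a finite-dimensional commutative $\mathbb Q$-algebra with an augmentation $W\to\mathbb Q$ with nilpotent kernel) the canonical map $R\otimes W\to R^{\operatorname{Spec}_R W}$ is an isomorphism, where $\operatorname{Spec}_R W$ is the object of algebra maps $W\to R$. Let $D(d)=\{v\in R^d : v_iv_j=0 \text{ for all } i,j\}$. For $v,w\in R^d$ write $v\sim w$ if $w-v\in D(d)$. "Points" are generalized elements (sections over an arbitrary stage $c\in\mathcal C$), and statements about them are understood in the internal sense. Let $M$ be a $d$-dimensional formal manifold: an object of $\mathcal E$ with a jointly epic family of subobjects $U_i\subseteq M$, each identified by a chart with a formally open subobject of $R^d$ (one closed under $\sim$), and each formally open in $M$ (if $p\sim q$ in some chart $U_j$ and $p\in U_i$, then $q\in U_i$). For points $p,q$ of $M$, $p\sim q$ ("neighbours") means that there is a chart containing both, in which their coordinates are neighbours. An *affine connection* on $M$ is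 a morphism $(z,x,y)\mapsto[zxy]\in M$, defined for $x\sim y$ and $x\sim z$, with $$[zxy]\sim y,\quad [zxy]\sim z,\quad [zxx]=z,\quad [xxy]=y,\quad [[zxy]yx]=z .$$ It is *symmetric* (torsion free) if $[zxy]=[yxz]$, and *flat* (curvature free) if $[[wxy]yz]=[wxz]$ whenever $x,y,z$ are mutual neighbours and $w\sim x$. A *path of length $n$ with domain $x$* is a tuple $(x=y_0,y_1,\dots,y_n)$ of points of $M$ with $y_i\sim y_{i+1}$ for $i<n$. Two paths $\underline y=(x,y_1,\dots,y_n)$ and $\underline z=(x,z_1,\dots,z_m)$ span the grid $(u_{i,j})_{0\le i\le m,\,0\le j\le n}$ given by $u_{0,j}=y_j$, $u_{i,0}=z_i$ and $$u_{i+1,j+1}=[\,u_{i+1,j}\;u_{i,j}\;u_{i,j+1}\,].$$ **Proposition 3.1.** Let $M$ be a formal manifold with a symmetric and flat affine connection. Then the corner $u_{m,n}$ of the grid spanned by two paths $\underline y$ and $\underline z$ with common domain $x$ depends only on $x$, $y_n$ and $z_m$: if $\underline y',\underline z'$ are further paths with domain $x$, of lengths $n'$ and $m'$, with $y'_{n'}=y_n$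 and $z'_{m'}=z_m$, then the grid $u'$ that they span has $u'_{m',n'}=u_{m,n}$. -/

import Mathlib

open CategoryTheory Opposite
open scoped TensorProduct

universe t w₂ w₁ v u

namespace SDG

/-! ### Combinatorial part: affine connections, paths and grids on a set with a relation -/

/-- `op z x y`, written `[zxy]` in the comments, is an affine connection for the neighbour relation
`r`. Only the values `[zxy]` with `x ∼ y` and `x ∼ z` have a meaning (the operation is partial);
all the laws are restricted to such arguments. -/
structure IsAffineConnection {X : Type*} (r : X → X → Prop) (op : X → X → X → X) : Prop where
  /-- book-keeping: `[zxy] ∼ y` -/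
  nbr_active : ∀ x y z, r x y → r x z → r (op z x y) y
  /-- book-keeping: `[zxy] ∼ z` -/
  nbr_passive : ∀ x y z, r x y → r x z → r (op z x y) z
  /-- unit law: `[zxx] = z` -/
  unit_left : ∀ x z, r x z → op z x x = z
  /-- unit law: `[xxy] = y` -/
  unit_right : ∀ x y, r x y → op x x y = y
  /-- inversion law: `[[zxy]yx] = z` -/
  inversion : ∀ x y z, r x y → r x z → op (op z x y) y x = z

/-- Symmetric (torsion free): `[zxy] = [yxz]`. -/
def IsTorsionFree {X : Type*} (r : X → X → Prop) (op : X → X → X → X) : Prop :=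
  ∀ x y z, r x y → r x z → op z x y = op y x z

/-- Flat (curvature free): writing `∇(x,y)` for the bijection `w ↦ [wxy]` from the monad of `x` to
the monad of `y`, one has `∇(x,y).∇(y,z) = ∇(x,z)` (composed from left to right) whenever
`x, y, z` are mutual neighbours. -/
def IsFlat {X : Type*} (r : X → X → Prop) (op : X → X → X → X) : Prop :=
  ∀ x y z, r x y → r y z → r x z → ∀ w, r x w → op (op w x y) y z = op w x z

/-- The entries `p 0, …, p n` form an `n`-path with domain `x` (the values `p i` for `i > n` play
no role). -/
structure IsPath {X : Type*} (r : X → X → Prop) (x : X) (n : ℕ) (p : ℕ → X) : Prop where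
  domain : p 0 = x
  step : ∀ i < n, r (p i) (p (i + 1))

/-- The grid `u i j` spanned by two paths `y` and `z` with a common domain:
`u 0 j = y j`, `u i 0 = z i`, and `u (i+1) (j+1) = [u (i+1) j, u i j, u i (j+1)]`. -/
def grid {X : Type*} (op : X → X → X → X) (y z : ℕ → X) : ℕ → ℕ → X
  | 0, j => y j
  | i + 1, 0 => z (i + 1)
  | i + 1, j + 1 => op (grid op y z (i + 1) j) (grid op y z i j) (grid op y z i (j + 1))

/-! ### The ring of scalars and the Kock-Lawvere axiom -/

/-- Weil algebras over `ℚ`: finite dimensional commutative `ℚ`-algebras with an augmentation to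
`ℚ` whose kernel is nilpotent. -/
structure IsWeilAlgebra (W : Type) [CommRing W] [Algebra ℚ W] : Prop where
  finite : Module.Finite ℚ W
  augmentation : ∃ π : W →ₐ[ℚ] ℚ, ∀ a, π a = 0 → IsNilpotent a

/-- Evaluation of an element `∑ aₖ ⊗ wₖ` of `A ⊗ W`, regarded as a function on the `B`-points of
`Spec W`, at the point `h : W → B`: it is `∑ f aₖ * h wₖ`. -/
noncomputable def weilEval {A B W : Type*} [CommRing A] [Algebra ℚ A] [CommRing B] [Algebra ℚ B]
    [CommRing W] [Algebra ℚ W] (f : A →ₐ[ℚ] B) (h : W →ₐ[ℚ] B) : A ⊗[ℚ] W →ₐ[ℚ] B :=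
  Algebra.TensorProduct.lift f h (fun _ _ => Commute.all _ _)

variable {C : Type u} [Category.{v} C] {J : GrothendieckTopology C}

/-- A section over the stage `c` of the exponential object `R ^ (Spec_R W)`, where `Spec_R W` is
the object `d ↦ Hom(W, R d)`: a family of maps `Hom(W, R d) → R d`, indexed by `f : d ⟶ c` and
natural in `d`. -/
structure WeilFunction (R : Cᵒᵖ ⥤ CommAlgCat.{w₁} ℚ) (W : Type) [CommRing W] [Algebra ℚ W]
    (c : C) where
  toFun : ∀ {d : C}, (d ⟶ c) → (W →ₐ[ℚ] R.obj (op d)) → R.obj (op d)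
  natural : ∀ {d e : C} (f : d ⟶ c) (g : e ⟶ d) (h : W →ₐ[ℚ] R.obj (op d)),
    toFun (g ≫ f) ((R.map g.op).hom.comp h) = (R.map g.op).hom (toFun f h)

/-- The general Kock-Lawvere axiom for the `ℚ`-algebra object `R`: for every Weil algebra `W` the
canonical map `R ⊗ W → R ^ (Spec_R W)` is an isomorphism, i.e. bijective at every stage `c`. -/
def KockLawvere (R : Cᵒᵖ ⥤ CommAlgCat.{w₁} ℚ) : Prop :=
  ∀ (W : Type) [CommRing W] [Algebra ℚ W], IsWeilAlgebra W →
    ∀ (c : C) (F : WeilFunction R W c),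
      ∃! a : R.obj (op c) ⊗[ℚ] W, ∀ (d : C) (f : d ⟶ c) (h : W →ₐ[ℚ] R.obj (op d)),
        F.toFun f h = weilEval (R.map f.op).hom h a

/-! ### Formal manifolds and their neighbour relation -/

/-- The first order infinitesimal neighbourhood `D(n)` of `0` in `Aⁿ`. -/
def firstOrder (A : Type*) [CommRing A] (n : ℕ) : Set (Fin n → A) :=
  {d | ∀ i j, d i * d j = 0}

/-- An `n`-dimensional formal manifold in the topos of sheaves on `(C, J)` with ring of scalars
`R`: an object `carrier` with a jointly epic family of subobjects `dom i`, each of them identified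
by `chart i` with a formally open subobject of `Rⁿ`, and each of them formally open in the
manifold. -/
structure FormalManifold (R : Sheaf J (CommAlgCat.{w₁} ℚ)) (n : ℕ) where
  /-- the underlying object of the topos -/
  carrier : Sheaf J (Type w₂)
  /-- the index set of the atlas -/
  ι : Type t
  /-- the chart domains -/
  dom : ι → Subfunctor carrier.obj
  /-- the chart domains are subsheaves -/
  dom_local : ∀ (i : ι) (c : C) (x : carrier.obj.obj (op c)),
    (dom i).sieveOfSection x ∈ J c → x ∈ (dom i).obj (op c)
  /-- the chart domains cover the manifold (locally in the sense of `J`) -/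
  cover : ∀ (c : C) (x : carrier.obj.obj (op c)), ∃ S ∈ J c, ∀ (d : C) (f : d ⟶ c), S f →
    ∃ i, carrier.obj.map f.op x ∈ (dom i).obj (op d)
  /-- the coordinates in a chart -/
  chart : ∀ (i : ι) {c : C}, (dom i).obj (op c) → Fin n → R.obj.obj (op c)
  chart_natural : ∀ (i : ι) {c d : C} (f : d ⟶ c) (x : (dom i).obj (op c)) (k : Fin n),
    chart i ⟨carrier.obj.map f.op x, (dom i).map f.op x.2⟩ k =
      (R.obj.map f.op).hom (chart i x k)
  chart_injective : ∀ (i : ι) (c : C), Function.Injective (chart i (c := c))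
  /-- the image of a chart is formally open in `Rⁿ` -/
  chart_open : ∀ (i : ι) {c : C} (x : (dom i).obj (op c)),
    ∀ d ∈ firstOrder (R.obj.obj (op c)) n, ∃ y : (dom i).obj (op c), chart i y = chart i x + d
  /-- the chart domains are formally open in the manifold: if `x ∼ y` in the chart `j` and `x`
  lies in the domain of the chart `i`, then so does `y` -/
  dom_open : ∀ (i j : ι) {c : C} (x y : (dom j).obj (op c)),
    chart j y - chart j x ∈ firstOrder (R.obj.obj (op c)) n →
      x.1 ∈ (dom i).obj (op c) → y.1 ∈ (dom i).obj (op c)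

namespace FormalManifold

variable {R : Sheaf J (CommAlgCat.{w₁} ℚ)} {n : ℕ}

/-- The generalized points of `M` at the stage `c`. -/
abbrev Pt (M : FormalManifold.{t, w₂} R n) (c : C) : Type w₂ := M.carrier.obj.obj (op c)

/-- Restriction of generalized points along a change of stage. -/
abbrev res (M : FormalManifold.{t, w₂} R n) {c d : C} (f : d ⟶ c) (x : M.Pt c) : M.Pt d :=
  M.carrier.obj.map f.op x

/-- `x` and `y` lie in a common chart, where their difference is in `D(n)`. -/
def ChartNbr (M : FormalManifold.{t, w₂} R n) {c : C} (x y : M.Pt c) : Prop :=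
  ∃ (i : M.ι) (hx : x ∈ (M.dom i).obj (op c)) (hy : y ∈ (M.dom i).obj (op c)),
    M.chart i ⟨y, hy⟩ - M.chart i ⟨x, hx⟩ ∈ firstOrder (R.obj.obj (op c)) n

/-- The first order neighbour relation `x ∼ y` between generalized points of `M`: there is, in the
internal sense (that is, locally), a chart in which `y - x` is in `D(n)`. -/
def Nbr (M : FormalManifold.{t, w₂} R n) (c : C) (x y : M.Pt c) : Prop :=
  ∃ S ∈ J c, ∀ (d : C) (f : d ⟶ c), S f → M.ChartNbr (M.res f x) (M.res f y)

/-- An affine connection on the manifold `M`: a morphism `(z, x, y) ↦ [zxy]` in the topos, defined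
on the object of those `(z, x, y)` with `x ∼ y` and `x ∼ z`, with the laws of an affine connection.
It is given by its action on generalized points, with irrelevant values at other triples. -/
structure AffineConnection (M : FormalManifold.{t, w₂} R n) where
  bracket : ∀ (c : C), M.Pt c → M.Pt c → M.Pt c → M.Pt c
  natural : ∀ {c d : C} (f : d ⟶ c) (x y z : M.Pt c), M.Nbr c x y → M.Nbr c x z →
    M.res f (bracket c z x y) = bracket d (M.res f z) (M.res f x) (M.res f y)
  laws : ∀ c : C, IsAffineConnection (M.Nbr c) (bracket c)

namespace AffineConnection

variable {M : FormalManifold.{t, w₂} R n}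

/-- The connection is symmetric (torsion free), at all stages. -/
def Symmetric (Λ : M.AffineConnection) : Prop :=
  ∀ c : C, IsTorsionFree (M.Nbr c) (Λ.bracket c)

/-- The connection is flat (curvature free), at all stages. -/
def Flat (Λ : M.AffineConnection) : Prop :=
  ∀ c : C, IsFlat (M.Nbr c) (Λ.bracket c)

end AffineConnection

end FormalManifold

end SDG

/-! Row `i + 1` of a grid is the transport of `z (i + 1)` along row `i`. If transport along a path
depends only on its end points (`IsPathIndependent`), then induction over the rows shows that the
corner depends on the first path only through its end. Torsion freeness makes the grid symmetric
under transposition (`grid_transpose`), so the same holds for the second path (`grid_eq`).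

Path independence comes from flatness and is a local question. Chart domains are closed under
neighbours, so a path starting in a chart stays there and amounts to a sequence of steps in `D(d)`;
padding with zero steps makes two paths equally long. Each coordinate of the transported point is a
natural function on `D(d) ^ N`, hence multi-affine by Kock-Lawvere (`existsUnique_multiaffine`).

Flatness says that two steps `v, w` may be replaced by `v + w`, but only when `v + w` is again in
`D(d)`. Testing on the generic such pair, which lives over `SkewAlgebra`, shows that this already
makes the coefficients symmetric, so arbitrary steps commute (`symmetric_of_add`,
`transportSteps_swap`). Finally, a symmetric multi-affine function is a linear functional of `∏ (1 +
lin (v i)) = exp (lin (∑ v i))` and so sees only the sum of the steps, which telescopes to the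
difference of the end points (`symmetric_multiaffine_eq`). -/

namespace SDG

/-! ### Symmetric multi-affine functions of first order infinitesimals. -/

section MultiAffine

variable {A : Type*} [CommRing A] [Algebra ℚ A]

/-- Two tuples with the same fibre cardinalities differ by a permutation of the indices. -/
lemma exists_perm_comp_eq {ι α : Type*} [Fintype ι] [DecidableEq α] {s t : ι → α}
    (h : ∀ a, Fintype.card {i // s i = a} = Fintype.card {i // t i = a}) :
    ∃ σ : Equiv.Perm ι, t ∘ σ = s :=
  ⟨Equiv.ofFiberEquiv fun a => Fintype.equivOfCardEq (h a),
    funext fun i => Equiv.ofFiberEquiv_map _ i⟩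

/-- The product of linear forms `1 + v i`, with `v i` of square zero, depends only on the sum. -/
lemma prod_one_add_eq_exp {ι : Type*} (I : Finset ι) (v : ι → A) (hv : ∀ i, v i * v i = 0) :
    IsNilpotent (∑ i ∈ I, v i) ∧ ∏ i ∈ I, (1 + v i) = IsNilpotent.exp (∑ i ∈ I, v i) := by
  classical
  have hnil : ∀ i, IsNilpotent (v i) := fun i => ⟨2, by rw [pow_two, hv]⟩
  induction I using Finset.induction_on with
  | empty => simp
  | insert a I ha ih =>
    rw [Finset.sum_insert ha, Finset.prod_insert ha]
    refine ⟨(Commute.all _ _).isNilpotent_add (hnil a) ih.1, ?_⟩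
    -- Additivity of `exp` needs both summands nilpotent, which is why nilpotency is carried through
    -- the induction. The factor `1 + v a` is the whole series of `exp (v a)`.
    rw [IsNilpotent.exp_add_of_commute (Commute.all _ _) (hnil a) ih.1, ih.2]
    congr 1
    rw [IsNilpotent.exp_eq_sum (k := 2) (by rw [pow_two, hv])]
    simp [Finset.sum_range_succ]

/-- The monomial of a tuple of optional indices; `none` contributes the factor `1`. -/
noncomputable def optionMonomial {n d : ℕ} (s : Fin n → Option (Fin d)) : Fin d →₀ ℕ :=
  ∑ i, (s i).elim 0 (fun k => Finsupp.single k 1)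

lemma optionMonomial_apply {n d : ℕ} (s : Fin n → Option (Fin d)) (k : Fin d) :
    optionMonomial s k = Fintype.card {i // s i = some k} := by
  rw [optionMonomial, Finsupp.finsetSum_apply, Fintype.card_subtype, Finset.card_filter]
  refine Finset.sum_congr rfl fun i _ => ?_
  cases h : s i with
  | none => simp
  | some l => simp [Finsupp.single_apply]

lemma exists_perm_of_optionMonomial_eq {n d : ℕ} {s t : Fin n → Option (Fin d)}
    (h : optionMonomial s = optionMonomial t) : ∃ σ : Equiv.Perm (Fin n), t ∘ σ = s := by
  have hsome : ∀ k : Fin d,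
      Fintype.card {i // s i = some k} = Fintype.card {i // t i = some k} := fun k => by
    rw [← optionMonomial_apply, ← optionMonomial_apply, h]
  -- `none` leaves no trace in the monomial; its multiplicity is what the other fibres leave of `n`.
  have total : ∀ s : Fin n → Option (Fin d), n = Fintype.card {i // s i = none} +
      ∑ k, Fintype.card {i // s i = some k} := fun s => by
    have := Fintype.card_congr (Equiv.sigmaFiberEquiv s)
    rw [Fintype.card_sigma, Fintype.sum_option, Fintype.card_fin] at this
    exact this.symm
  refine exists_perm_comp_eq fun o => ?_
  cases o with
  | some k => exact hsome k
  | none =>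
    have h1 := total s
    have h2 := total t
    simp only [hsome] at h1
    omega

/-- A symmetric multi-affine function of first order infinitesimals depends only on their sum. -/
lemma symmetric_multiaffine_eq {n d : ℕ} (C : (Fin n → Option (Fin d)) → A)
    (hC : ∀ (σ : Equiv.Perm (Fin n)) s, C (s ∘ σ) = C s) {v v' : Fin n → Fin d → A}
    (hv : ∀ i, v i ∈ firstOrder A d) (hv' : ∀ i, v' i ∈ firstOrder A d)
    (hsum : ∑ i, v i = ∑ i, v' i) :
    ∑ s, C s * ∏ i, (s i).elim 1 (v i) = ∑ s, C s * ∏ i, (s i).elim 1 (v' i) := by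
  classical
  -- By symmetry `C s` depends only on the monomial of `s`, so any preimage may be chosen. The value
  -- `0` at exponents that do not occur is never used.
  let coeffs : (Fin d →₀ ℕ) → A := fun α =>
    if h : ∃ s : Fin n → Option (Fin d), optionMonomial s = α then C h.choose else 0
  have hcoeffs : ∀ s, coeffs (optionMonomial s) = C s := fun s => by
    have h : ∃ t : Fin n → Option (Fin d), optionMonomial t = optionMonomial s := ⟨s, rfl⟩
    obtain ⟨σ, hσ⟩ := exists_perm_of_optionMonomial_eq h.choose_spec
    simp only [coeffs, dif_pos h]
    rw [← hσ, hC]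
  let Φ : MvPolynomial (Fin d) A →ₗ[A] A :=
    (MvPolynomial.basisMonomials (Fin d) A).constr A coeffs
  have hΦ : ∀ α a, Φ (MvPolynomial.monomial α a) = a * coeffs α := fun α a => by
    have : MvPolynomial.monomial α a = a • MvPolynomial.basisMonomials (Fin d) A α := by
      simp [MvPolynomial.smul_monomial]
    rw [this, map_smul, Module.Basis.constr_basis, smul_eq_mul]
  let lin : (Fin d → A) → MvPolynomial (Fin d) A := fun w =>
    ∑ k, MvPolynomial.monomial (Finsupp.single k 1) (w k)
  have hlin_sq : ∀ w ∈ firstOrder A d, lin w * lin w = 0 := fun w hw => by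
    simp only [lin, Finset.sum_mul_sum, MvPolynomial.monomial_mul]
    exact Finset.sum_eq_zero fun i _ => Finset.sum_eq_zero fun j _ => by
      rw [hw i j, MvPolynomial.monomial_zero]
  -- A tuple `s` records which term is picked from each factor: `none` for `1`, `some k` for the
  -- `k`-th term of the linear form.
  have expand : ∀ w : Fin n → Fin d → A,
      ∑ s, C s * ∏ i, (s i).elim 1 (w i) = Φ (∏ i, (1 + lin (w i))) := fun w => by
    have : ∀ i, 1 + lin (w i) = ∑ o : Option (Fin d), MvPolynomial.monomial
        (o.elim 0 (fun k => Finsupp.single k 1)) (o.elim 1 (w i)) := fun i => by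
      rw [Fintype.sum_option]
      simp [lin]
    simp only [this]
    rw [Finset.prod_univ_sum, map_sum, Fintype.piFinset_univ]
    refine Finset.sum_congr rfl fun s _ => ?_
    rw [← MvPolynomial.monomial_sum_prod, hΦ, mul_comm]
    exact congrArg _ (hcoeffs s).symm
  have hlin_sum : ∀ w : Fin n → Fin d → A, ∑ i, lin (w i) = lin (∑ i, w i) := fun w => by
    simp only [lin, Finset.sum_apply, map_sum]
    exact Finset.sum_comm
  rw [expand, expand, (prod_one_add_eq_exp _ _ fun i => hlin_sq _ (hv i)).2,
    (prod_one_add_eq_exp _ _ fun i => hlin_sq _ (hv' i)).2, hlin_sum, hlin_sum, hsum]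

end MultiAffine

/-! ### Consequences of the Kock-Lawvere axiom for functions on `D(d) ^ n`. -/

section Scalars

variable {C : Type u} [Category.{v} C] {R : Cᵒᵖ ⥤ CommAlgCat.{w₁} ℚ}

lemma firstOrder_map {A B : Type*} [CommRing A] [CommRing B] [Algebra ℚ A] [Algebra ℚ B]
    (f : A →ₐ[ℚ] B) {d : ℕ} {v : Fin d → A} (hv : v ∈ firstOrder A d) :
    f ∘ v ∈ firstOrder B d := fun i j => by
  simp only [Function.comp_apply, ← map_mul, hv i j, map_zero]

lemma zero_mem_firstOrder {A : Type*} [CommRing A] {d : ℕ} : (0 : Fin d → A) ∈ firstOrder A d :=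
  fun _ _ => by simp

/-- Restriction of scalars from one stage to another. -/
abbrev scalarRes (R : Cᵒᵖ ⥤ CommAlgCat.{w₁} ℚ) {c d : C} (f : d ⟶ c) :
    R.obj (op c) →ₐ[ℚ] R.obj (op d) := (R.map f.op).hom

lemma scalarRes_comp {c d e : C} (f : d ⟶ c) (g : e ⟶ d) (a : R.obj (op c)) :
    scalarRes R (g ≫ f) a = scalarRes R g (scalarRes R f a) := by
  simp [scalarRes]

lemma scalarRes_id {c : C} (a : R.obj (op c)) : scalarRes R (𝟙 c) a = a := by
  simp [scalarRes]

@[simp]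
lemma weilEval_tmul {A B W : Type*} [CommRing A] [Algebra ℚ A] [CommRing B] [Algebra ℚ B]
    [CommRing W] [Algebra ℚ W] (f : A →ₐ[ℚ] B) (h : W →ₐ[ℚ] B) (a : A) (w : W) :
    weilEval f h (a ⊗ₜ w) = f a * h w := by
  simp [weilEval]

/-- The function on `Spec W` given by an element of `R ⊗ W`. -/
noncomputable def WeilFunction.ofTensor {W : Type} [CommRing W] [Algebra ℚ W] {c : C}
    (a : R.obj (op c) ⊗[ℚ] W) : WeilFunction R W c where
  toFun f h := weilEval (R.map f.op).hom h a
  natural f g h := by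
    induction a using TensorProduct.induction_on with
    | zero => simp
    | tmul a w => simp
    | add a b ha hb => simp only [map_add, ha, hb]

/-- The uniqueness half of the axiom, applied to the function that `a` represents. -/
lemma KockLawvere.ext (hR : KockLawvere R) {W : Type} [CommRing W] [Algebra ℚ W]
    (hW : IsWeilAlgebra W) {c : C} (a b : R.obj (op c) ⊗[ℚ] W)
    (h : ∀ (d : C) (f : d ⟶ c) (h : W →ₐ[ℚ] R.obj (op d)),
      weilEval (scalarRes R f) h a = weilEval (scalarRes R f) h b) : a = b :=
  (hR W hW c (WeilFunction.ofTensor a)).unique (fun _ _ _ => rfl) h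

/-! #### Functions of first order infinitesimals -/

/-- A natural family of functions of `n` elements of `D(d)`, over the stage `c`. -/
def IsNatural {n d : ℕ} {c : C}
    (F : ∀ ⦃e : C⦄, (e ⟶ c) → (Fin n → Fin d → R.obj (op e)) → R.obj (op e)) : Prop :=
  ∀ ⦃e e' : C⦄ (f : e ⟶ c) (g : e' ⟶ e) (v : Fin n → Fin d → R.obj (op e)),
    (∀ i, v i ∈ firstOrder (R.obj (op e)) d) →
      F (g ≫ f) (fun i => scalarRes R g ∘ v i) = scalarRes R g (F f v)

lemma isWeilAlgebra_trivSqZeroExt (d : ℕ) : IsWeilAlgebra (TrivSqZeroExt ℚ (Fin d → ℚ)) where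
  finite := inferInstanceAs (Module.Finite ℚ (ℚ × (Fin d → ℚ)))
  augmentation := ⟨TrivSqZeroExt.fstHom ℚ ℚ (Fin d → ℚ), fun a ha => by
    rw [TrivSqZeroExt.isNilpotent_iff_isNilpotent_fst]
    exact ⟨1, by simpa using ha⟩⟩

/-- The `A`-point of the spectrum of `ℚ ⊕ ℚᵈ` (square zero extension) given by an element of `D(d)`. -/
noncomputable def firstOrderPoint {A : Type*} [CommRing A] [Algebra ℚ A] {d : ℕ} (v : Fin d → A)
    (hv : v ∈ firstOrder A d) : TrivSqZeroExt ℚ (Fin d → ℚ) →ₐ[ℚ] A :=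
  TrivSqZeroExt.liftEquivOfComm ⟨Fintype.linearCombination ℚ v, fun x y => by
    simp only [Fintype.linearCombination_apply, Finset.sum_mul_sum]
    exact Finset.sum_eq_zero fun i _ => Finset.sum_eq_zero fun j _ => by
      rw [smul_mul_smul_comm, hv i j, smul_zero]⟩

lemma firstOrderPoint_inr {A : Type*} [CommRing A] [Algebra ℚ A] {d : ℕ} (v : Fin d → A)
    (hv : v ∈ firstOrder A d) (k : Fin d) :
    firstOrderPoint v hv (TrivSqZeroExt.inr (Pi.single k 1)) = v k := by
  simp [firstOrderPoint]

/-- The images of the basis vectors of the square zero ideal determine `h`, and their products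
vanish; thus the spectrum is exactly `D(d)`. -/
lemma exists_firstOrderPoint_eq {A : Type*} [CommRing A] [Algebra ℚ A] {d : ℕ}
    (h : TrivSqZeroExt ℚ (Fin d → ℚ) →ₐ[ℚ] A) :
    ∃ v hv, h = firstOrderPoint v hv := by
  have hv : (fun k => h (TrivSqZeroExt.inr (Pi.single k 1))) ∈ firstOrder A d := fun i j => by
    rw [← map_mul, TrivSqZeroExt.inr_mul_inr, map_zero]
  have : h.toLinearMap ∘ₗ TrivSqZeroExt.inrHom ℚ (Fin d → ℚ) =
      (firstOrderPoint _ hv).toLinearMap ∘ₗ TrivSqZeroExt.inrHom ℚ (Fin d → ℚ) :=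
    LinearMap.pi_ext' fun k => LinearMap.ext_ring (by
      simpa using (firstOrderPoint_inr _ hv k).symm)
  exact ⟨_, hv, TrivSqZeroExt.algHom_ext fun x => LinearMap.congr_fun this x⟩

/-- The element of `A ⊗ W` with given coefficients, for `W` the square zero extension `ℚ ⊕ ℚᵈ`. -/
noncomputable def affineTensor {A : Type*} [CommRing A] [Algebra ℚ A] {d : ℕ}
    (a : Option (Fin d) → A) : A ⊗[ℚ] TrivSqZeroExt ℚ (Fin d → ℚ) :=
  ∑ o, a o ⊗ₜ[ℚ] o.elim 1 (fun k => TrivSqZeroExt.inr (Pi.single k 1))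

lemma weilEval_affineTensor {A B : Type*} [CommRing A] [Algebra ℚ A] [CommRing B] [Algebra ℚ B]
    {d : ℕ} (f : A →ₐ[ℚ] B) (a : Option (Fin d) → A) (v : Fin d → B) (hv : v ∈ firstOrder B d) :
    weilEval f (firstOrderPoint v hv) (affineTensor a) = ∑ o, f (a o) * o.elim 1 v := by
  rw [affineTensor, map_sum]
  refine Finset.sum_congr rfl fun o _ => ?_
  rw [weilEval_tmul]
  cases o with
  | none => simp
  | some k => simp only [Option.elim_some, firstOrderPoint_inr]

lemma affineTensor_surjective {A : Type*} [CommRing A] [Algebra ℚ A] {d : ℕ}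
    (x : A ⊗[ℚ] TrivSqZeroExt ℚ (Fin d → ℚ)) : ∃ a, x = affineTensor a := by
  induction x using TensorProduct.induction_on with
  | zero => exact ⟨0, by simp [affineTensor]⟩
  | add x y hx hy =>
    obtain ⟨a, rfl⟩ := hx
    obtain ⟨b, rfl⟩ := hy
    exact ⟨a + b, by simp [affineTensor, TensorProduct.add_tmul, Finset.sum_add_distrib]⟩
  | tmul a w =>
    refine ⟨fun o => o.elim (w.fst • a) (fun k => w.snd k • a), ?_⟩
    have hw : w = w.fst • (1 : TrivSqZeroExt ℚ (Fin d → ℚ)) +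
        ∑ k, w.snd k • TrivSqZeroExt.inr (Pi.single k (1 : ℚ)) := by
      ext k
      · simp [TrivSqZeroExt.fst_sum]
      · simp [TrivSqZeroExt.snd_sum, Finset.sum_apply, Pi.single_apply]
    conv_lhs => rw [hw]
    simp [affineTensor, Fintype.sum_option, TensorProduct.tmul_add, TensorProduct.tmul_sum,
      TensorProduct.smul_tmul]

lemma affineTensor_injective {A : Type*} [CommRing A] [Algebra ℚ A] {d : ℕ} :
    Function.Injective (affineTensor (A := A) (d := d)) := by
  intro a b hab
  have key : ∀ (φ : TrivSqZeroExt ℚ (Fin d → ℚ) →ₗ[ℚ] ℚ),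
      ∑ o : Option (Fin d), φ (o.elim 1 (fun k => TrivSqZeroExt.inr (Pi.single k 1))) • a o =
      ∑ o : Option (Fin d), φ (o.elim 1 (fun k => TrivSqZeroExt.inr (Pi.single k 1))) • b o := by
    intro φ
    simpa [affineTensor] using
      congrArg ((TensorProduct.rid ℚ A).toLinearMap ∘ₗ LinearMap.lTensor A φ) hab
  funext o
  cases o with
  | none =>
    simpa [Fintype.sum_option] using key (TrivSqZeroExt.fstHom ℚ ℚ (Fin d → ℚ)).toLinearMap
  | some k =>
    simpa [Fintype.sum_option, Pi.single_apply] using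
      key (LinearMap.proj k ∘ₗ TrivSqZeroExt.sndHom ℚ (Fin d → ℚ))

/-- Functions on `D(d)` are affine, with unique coefficients. -/
lemma KockLawvere.existsUnique_affine (hR : KockLawvere R) {d : ℕ} {c : C}
    (F : ∀ ⦃e : C⦄, (e ⟶ c) → (Fin d → R.obj (op e)) → R.obj (op e))
    (hF : ∀ ⦃e e' : C⦄ (f : e ⟶ c) (g : e' ⟶ e) (v : Fin d → R.obj (op e)),
      v ∈ firstOrder (R.obj (op e)) d →
        F (g ≫ f) (scalarRes R g ∘ v) = scalarRes R g (F f v)) :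
    ∃! a : Option (Fin d) → R.obj (op c), ∀ (e : C) (f : e ⟶ c) (v : Fin d → R.obj (op e)),
      v ∈ firstOrder (R.obj (op e)) d → F f v = ∑ o, scalarRes R f (a o) * o.elim 1 v := by
  let G : WeilFunction R (TrivSqZeroExt ℚ (Fin d → ℚ)) c :=
    { toFun := fun f h => F f (fun k => h (TrivSqZeroExt.inr (Pi.single k 1)))
      natural := fun f g h => hF f g _ fun i j => by
        rw [← map_mul, TrivSqZeroExt.inr_mul_inr, map_zero] }
  have hG : ∀ {e : C} (f : e ⟶ c) (v : Fin d → R.obj (op e)) hv,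
      G.toFun f (firstOrderPoint v hv) = F f v := fun f v hv => by
    simp only [G, firstOrderPoint_inr]
  obtain ⟨x, hx, hux⟩ := hR _ (isWeilAlgebra_trivSqZeroExt d) c G
  obtain ⟨a, rfl⟩ := affineTensor_surjective x
  refine ⟨a, fun e f v hv => ?_, fun b hb => affineTensor_injective (hux _ fun e f h => ?_)⟩
  · rw [← hG f v hv, hx, weilEval_affineTensor]
  · obtain ⟨v, hv, rfl⟩ := exists_firstOrderPoint_eq h
    rw [hG, hb e f v hv, weilEval_affineTensor]

/-- Functions on `D(d) ^ n` are multi-affine, with unique coefficients. -/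
lemma KockLawvere.existsUnique_multiaffine (hR : KockLawvere R) {d : ℕ} (n : ℕ) {c : C}
    (F : ∀ ⦃e : C⦄, (e ⟶ c) → (Fin n → Fin d → R.obj (op e)) → R.obj (op e))
    (hF : IsNatural F) :
    ∃! a : (Fin n → Option (Fin d)) → R.obj (op c),
      ∀ (e : C) (f : e ⟶ c) (v : Fin n → Fin d → R.obj (op e)),
        (∀ i, v i ∈ firstOrder (R.obj (op e)) d) →
          F f v = ∑ s, scalarRes R f (a s) * ∏ i, (s i).elim 1 (v i) := by
  induction n generalizing c with
  | zero =>
    refine ⟨fun _ => F (𝟙 c) Fin.elim0, fun e f v hv => ?_, fun b hb => funext fun s => ?_⟩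
    · have := hF (𝟙 c) f Fin.elim0 (fun i => i.elim0)
      rw [Category.comp_id] at this
      simp [← this, Subsingleton.elim (fun i : Fin 0 => _ ∘ _) v]
    · have := hb c (𝟙 c) Fin.elim0 (fun i => i.elim0)
      simp only [scalarRes_id] at this
      have hs : ∀ s', b s' = b s := fun s' => congrArg b (Subsingleton.elim _ _)
      simp [this, hs]
  | succ n ih =>
    -- Currying: with the first vector `w` fixed at stage `e`, the rest is a function of `n` vectors
    -- over `e`, where `w` is restricted to each later stage.
    have hF' : ∀ {e : C} (f : e ⟶ c) (w : Fin d → R.obj (op e)),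
        w ∈ firstOrder (R.obj (op e)) d →
        IsNatural (R := R) (n := n) (fun ⦃e'⦄ (g : e' ⟶ e) v =>
          F (g ≫ f) (Fin.cons (scalarRes R g ∘ w) v : Fin (n + 1) → Fin d → R.obj (op e'))) := by
      intro e f w hw e' e'' g g' v hv
      have := hF (g ≫ f) g' (Fin.cons (scalarRes R g ∘ w) v : Fin (n + 1) → Fin d → _)
        (Fin.cases (firstOrder_map _ hw) hv)
      simp only [Category.assoc]
      rw [← this]
      congr 1
      funext i
      refine Fin.cases ?_ (fun i => ?_) i
      · exact funext fun k => scalarRes_comp _ _ _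
      · simp
    choose! a ha hua using fun (e : C) (f : e ⟶ c) (w : Fin d → R.obj (op e))
      (hw : w ∈ firstOrder (R.obj (op e)) d) => ih _ (hF' f w hw)
    -- Uniqueness of the coefficients makes them natural in `w`, so each of them is in turn an
    -- affine function of `w`.
    have anat : ∀ s ⦃e e' : C⦄ (f : e ⟶ c) (g : e' ⟶ e) (w : Fin d → R.obj (op e)),
        w ∈ firstOrder (R.obj (op e)) d →
          a e' (g ≫ f) (scalarRes R g ∘ w) s = scalarRes R g (a e f w s) := by
      intro s e e' f g w hw
      refine congrFun (hua e' (g ≫ f) (scalarRes R g ∘ w) (firstOrder_map _ hw)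
        (fun s => scalarRes R g (a e f w s)) fun e'' h v hv => ?_).symm s
      have := ha e f w hw e'' (h ≫ g) v hv
      simp only [Category.assoc, scalarRes_comp] at this
      rw [← this]
      congr 2
      exact funext fun k => (scalarRes_comp _ _ _).symm
    choose b hb hub using fun s => hR.existsUnique_affine (fun e f w => a e f w s) (anat s)
    have split : ∀ {e : C} (coef : (Fin (n + 1) → Option (Fin d)) → R.obj (op e))
        (v : Fin (n + 1) → Fin d → R.obj (op e)),
        ∑ s, coef s * ∏ i, (s i).elim 1 (v i) =
        ∑ s : Fin n → Option (Fin d), (∑ o : Option (Fin d), coef (Fin.cons o s) *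
          o.elim 1 (v 0)) * ∏ i, (s i).elim 1 (v i.succ) := by
      intro e coef v
      rw [← (Fin.consEquiv fun _ => Option (Fin d)).sum_comp, Fintype.sum_prod_type_right]
      refine Finset.sum_congr rfl fun s _ => ?_
      rw [Finset.sum_mul]
      refine Finset.sum_congr rfl fun o _ => ?_
      simp [Fin.consEquiv, Fin.prod_univ_succ, mul_assoc]
    have expand : ∀ {e : C} (f : e ⟶ c) (v : Fin (n + 1) → Fin d → R.obj (op e)),
        (∀ i, v i ∈ firstOrder (R.obj (op e)) d) →
        F f v = ∑ s, a e f (v 0) s * ∏ i, (s i).elim 1 (v i.succ) := by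
      intro e f v hv
      have := ha e f (v 0) (hv 0) e (𝟙 e) (fun i => v i.succ) (fun i => hv _)
      simp only [Category.id_comp, scalarRes_id] at this
      rw [← this]
      congr 1
      funext i
      refine Fin.cases ?_ (fun i => ?_) i
      · exact funext fun k => (scalarRes_id _).symm
      · simp
    refine ⟨fun s => b (Fin.tail s) (s 0), fun e f v hv => ?_, fun b' hb' => ?_⟩
    · rw [split, expand f v hv]
      refine Finset.sum_congr rfl fun s _ => ?_
      rw [hb s e f (v 0) (hv 0)]
      simp
    · have : ∀ s, (fun o => b' (Fin.cons o s)) = b s := by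
        intro s
        refine hub s _ fun e f w hw => ?_
        refine (congrFun (hua e f w hw (fun s => ∑ o, scalarRes R f (b' (Fin.cons o s)) *
          o.elim 1 w) fun e' g v hv => ?_) s).symm
        simp only
        rw [hb' e' (g ≫ f) _ (Fin.cases (firstOrder_map _ hw) hv), split]
        refine Finset.sum_congr rfl fun s _ => ?_
        rw [map_sum]
        congr 1
        refine Finset.sum_congr rfl fun o _ => ?_
        rw [map_mul, scalarRes_comp]
        cases o <;> simp
      funext s
      rw [← this (Fin.tail s)]
      simp

/-- The Weil algebra `ℚ[s, t, s', t']` in which all products of two generators vanish except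
`s t' = q = - t s'`. It is the coordinate ring of a generic pair of vectors `(s, t)`, `(s', t')` in
`D(2)` whose sum is in `D(2)`. -/
@[ext]
structure SkewAlgebra where
  re : ℚ
  s : ℚ
  t : ℚ
  s' : ℚ
  t' : ℚ
  q : ℚ

namespace SkewAlgebra

instance : Zero SkewAlgebra := ⟨⟨0, 0, 0, 0, 0, 0⟩⟩
instance : One SkewAlgebra := ⟨⟨1, 0, 0, 0, 0, 0⟩⟩
instance : Add SkewAlgebra := ⟨fun a b =>
  ⟨a.re + b.re, a.s + b.s, a.t + b.t, a.s' + b.s', a.t' + b.t', a.q + b.q⟩⟩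
instance : Neg SkewAlgebra := ⟨fun a => ⟨-a.re, -a.s, -a.t, -a.s', -a.t', -a.q⟩⟩
instance : Mul SkewAlgebra := ⟨fun a b =>
  ⟨a.re * b.re, a.re * b.s + a.s * b.re, a.re * b.t + a.t * b.re, a.re * b.s' + a.s' * b.re,
    a.re * b.t' + a.t' * b.re,
    a.re * b.q + a.q * b.re + a.s * b.t' + a.t' * b.s - a.t * b.s' - a.s' * b.t⟩⟩

lemma zero_def : (0 : SkewAlgebra) = ⟨0, 0, 0, 0, 0, 0⟩ := rfl
lemma one_def : (1 : SkewAlgebra) = ⟨1, 0, 0, 0, 0, 0⟩ := rfl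
lemma add_def (a b : SkewAlgebra) : a + b =
  ⟨a.re + b.re, a.s + b.s, a.t + b.t, a.s' + b.s', a.t' + b.t', a.q + b.q⟩ := rfl
lemma neg_def (a : SkewAlgebra) : -a = ⟨-a.re, -a.s, -a.t, -a.s', -a.t', -a.q⟩ := rfl
lemma mul_def (a b : SkewAlgebra) : a * b =
  ⟨a.re * b.re, a.re * b.s + a.s * b.re, a.re * b.t + a.t * b.re, a.re * b.s' + a.s' * b.re,
    a.re * b.t' + a.t' * b.re,
    a.re * b.q + a.q * b.re + a.s * b.t' + a.t' * b.s - a.t * b.s' - a.s' * b.t⟩ := rfl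

instance : CommRing SkewAlgebra where
  add_assoc a b c := by ext <;> simp only [add_def] <;> ring
  zero_add a := by ext <;> simp only [add_def, zero_def] <;> ring
  add_zero a := by ext <;> simp only [add_def, zero_def] <;> ring
  add_comm a b := by ext <;> simp only [add_def] <;> ring
  neg_add_cancel a := by ext <;> simp only [add_def, neg_def, zero_def] <;> ring
  left_distrib a b c := by ext <;> simp only [add_def, mul_def] <;> ring
  right_distrib a b c := by ext <;> simp only [add_def, mul_def] <;> ring
  zero_mul a := by ext <;> simp only [mul_def, zero_def] <;> ring
  mul_zero a := by ext <;> simp only [mul_def, zero_def] <;> ring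
  mul_assoc a b c := by ext <;> simp only [mul_def] <;> ring
  one_mul a := by ext <;> simp only [mul_def, one_def] <;> ring
  mul_one a := by ext <;> simp only [mul_def, one_def] <;> ring
  mul_comm a b := by ext <;> simp only [mul_def] <;> ring
  nsmul := nsmulRec
  zsmul := zsmulRec

instance : Algebra ℚ SkewAlgebra := RingHom.toAlgebra
  { toFun := fun a => ⟨a, 0, 0, 0, 0, 0⟩
    map_one' := rfl
    map_zero' := rfl
    map_add' := fun a b => by ext <;> simp [add_def]
    map_mul' := fun a b => by ext <;> simp [mul_def] }

lemma algebraMap_def (a : ℚ) : algebraMap ℚ SkewAlgebra a = ⟨a, 0, 0, 0, 0, 0⟩ := rfl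

lemma smul_def (r : ℚ) (a : SkewAlgebra) :
    r • a = ⟨r * a.re, r * a.s, r * a.t, r * a.s', r * a.t', r * a.q⟩ := by
  rw [Algebra.smul_def, algebraMap_def, mul_def]
  ext <;> simp

/-- The coordinates with respect to the standard basis. -/
def coordinates : SkewAlgebra ≃ₗ[ℚ] ℚ × ℚ × ℚ × ℚ × ℚ × ℚ where
  toFun a := (a.re, a.s, a.t, a.s', a.t', a.q)
  invFun a := ⟨a.1, a.2.1, a.2.2.1, a.2.2.2.1, a.2.2.2.2.1, a.2.2.2.2.2⟩
  map_add' a b := rfl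
  map_smul' r a := by simp [smul_def]
  left_inv a := rfl
  right_inv a := rfl

/-- The coefficient of the socle generator. -/
def socleCoord : SkewAlgebra →ₗ[ℚ] ℚ where
  toFun := q
  map_add' a b := rfl
  map_smul' r a := by simp [smul_def]

/-- The augmentation. -/
def augmentation : SkewAlgebra →ₐ[ℚ] ℚ where
  toFun := re
  map_one' := rfl
  map_mul' _ _ := rfl
  map_zero' := rfl
  map_add' _ _ := rfl
  commutes' _ := rfl

lemma isWeilAlgebra : IsWeilAlgebra SkewAlgebra where
  finite := Module.Finite.equiv coordinates.symm
  -- A product of two elements of the augmentation ideal is a multiple of `q`, and `q` annihilates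
  -- the ideal.
  augmentation := ⟨augmentation, fun a (ha : a.re = 0) => ⟨3, by
      rw [pow_succ, pow_two]
      ext <;> simp [mul_def, zero_def, ha]⟩⟩

end SkewAlgebra

lemma sum_fin_two_option {A : Type*} [CommRing A] {d : ℕ}
    (a : (Fin 2 → Option (Fin d)) → A) (v w : Fin d → A) :
    ∑ s, a s * ∏ i, (s i).elim 1 (![v, w] i) =
      ∑ o : Option (Fin d), ∑ o' : Option (Fin d), a ![o, o'] * (o.elim 1 v * o'.elim 1 w) := by
  rw [← (finTwoArrowEquiv _).symm.sum_comp, Fintype.sum_prod_type]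
  simp [Fin.prod_univ_two]

/-- If the value of a function of two vectors `v, w` in `D(d)` depends only on the sum `v + w` as
soon as this sum is in `D(d)`, then the function is symmetric. -/
lemma KockLawvere.symmetric_of_add (hR : KockLawvere R) {d : ℕ} {c : C}
    (F : ∀ ⦃e : C⦄, (e ⟶ c) → (Fin d → R.obj (op e)) → (Fin d → R.obj (op e)) → R.obj (op e))
    (hF : ∀ ⦃e e' : C⦄ (f : e ⟶ c) (g : e' ⟶ e) (v w : Fin d → R.obj (op e)),
      v ∈ firstOrder (R.obj (op e)) d → w ∈ firstOrder (R.obj (op e)) d →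
        F (g ≫ f) (scalarRes R g ∘ v) (scalarRes R g ∘ w) = scalarRes R g (F f v w))
    (hadd : ∀ ⦃e : C⦄ (f : e ⟶ c) (v w : Fin d → R.obj (op e)),
      v ∈ firstOrder (R.obj (op e)) d → w ∈ firstOrder (R.obj (op e)) d →
        v + w ∈ firstOrder (R.obj (op e)) d → F f v w = F f (v + w) 0)
    {e : C} (f : e ⟶ c) {v w : Fin d → R.obj (op e)}
    (hv : v ∈ firstOrder (R.obj (op e)) d) (hw : w ∈ firstOrder (R.obj (op e)) d) :
    F f v w = F f w v := by
  obtain ⟨a, ha, -⟩ := hR.existsUnique_multiaffine (n := 2)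
    (fun e f (v : Fin 2 → Fin d → R.obj (op e)) => F f (v 0) (v 1))
    (fun e e' f g v hv => hF f g _ _ (hv 0) (hv 1))
  have expand : ∀ {e : C} (f : e ⟶ c) {v w : Fin d → R.obj (op e)},
      v ∈ firstOrder (R.obj (op e)) d → w ∈ firstOrder (R.obj (op e)) d → F f v w =
      ∑ o : Option (Fin d), ∑ o' : Option (Fin d),
        scalarRes R f (a ![o, o']) * (o.elim 1 v * o'.elim 1 w) := by
    intro e f v w hv hw
    rw [← sum_fin_two_option (fun s => scalarRes R f (a s)),
      ← ha e f ![v, w] (fun i => by fin_cases i <;> assumption)]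
    rfl
  -- The case `v = 0` of `hadd`: both coefficient families describe the same affine function on
  -- `D(d)`.
  have hlin : ∀ k, a ![none, some k] = a ![some k, none] := by
    intro k
    have huniq := (hR.existsUnique_affine (fun e f w => F f 0 w) (fun e e' f g w hw => by
      rw [← hF f g 0 w zero_mem_firstOrder hw]
      congr 1
      funext k
      simp)).unique (y₁ := fun o => a ![none, o]) (y₂ := fun o => a ![o, none]) ?_ ?_
    · exact congrFun huniq (some k)
    · intro e f w hw
      rw [expand f zero_mem_firstOrder hw, Fintype.sum_option]
      simp
    · intro e f w hw
      rw [hadd f 0 w zero_mem_firstOrder hw (by rwa [zero_add]), zero_add,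
        expand f hw zero_mem_firstOrder]
      simp [Fintype.sum_option]
  have hquad : ∀ k l, a ![some k, some l] = a ![some l, some k] := by
    intro k l
    let q : SkewAlgebra := ⟨0, 0, 0, 0, 0, 1⟩
    -- `q` is a basis element of the Weil algebra, so tensoring with it loses nothing, and the
    -- vanishing can be tested at points `h`.
    have hzero : (a ![some k, some l] - a ![some l, some k]) ⊗ₜ[ℚ] q = 0 := by
      refine hR.ext SkewAlgebra.isWeilAlgebra _ _ fun e f h => ?_
      let s := h ⟨0, 1, 0, 0, 0, 0⟩
      let t := h ⟨0, 0, 1, 0, 0, 0⟩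
      let s' := h ⟨0, 0, 0, 1, 0, 0⟩
      let t' := h ⟨0, 0, 0, 0, 1, 0⟩
      have hss : s * s = 0 := by
        simp only [s, ← map_mul, SkewAlgebra.mul_def]; simp [← SkewAlgebra.zero_def]
      have hst : s * t = 0 := by
        simp only [s, t, ← map_mul, SkewAlgebra.mul_def]; simp [← SkewAlgebra.zero_def]
      have htt : t * t = 0 := by
        simp only [t, ← map_mul, SkewAlgebra.mul_def]; simp [← SkewAlgebra.zero_def]
      have hss' : s * s' = 0 := by
        simp only [s, s', ← map_mul, SkewAlgebra.mul_def]; simp [← SkewAlgebra.zero_def]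
      have htt' : t * t' = 0 := by
        simp only [t, t', ← map_mul, SkewAlgebra.mul_def]; simp [← SkewAlgebra.zero_def]
      have hs's' : s' * s' = 0 := by
        simp only [s', ← map_mul, SkewAlgebra.mul_def]; simp [← SkewAlgebra.zero_def]
      have hs't' : s' * t' = 0 := by
        simp only [s', t', ← map_mul, SkewAlgebra.mul_def]; simp [← SkewAlgebra.zero_def]
      have ht't' : t' * t' = 0 := by
        simp only [t', ← map_mul, SkewAlgebra.mul_def]; simp [← SkewAlgebra.zero_def]
      have hst' : s * t' = h q := by
        simp only [s, t', q, ← map_mul, SkewAlgebra.mul_def]; simp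
      have hts' : t * s' = - h q := by
        simp only [t, s', q, ← map_mul, ← map_neg, SkewAlgebra.mul_def, SkewAlgebra.neg_def]; simp
      let v : Fin d → R.obj (op e) := Pi.single k s + Pi.single l t
      let w : Fin d → R.obj (op e) := Pi.single k s' + Pi.single l t'
      have hD : ∀ (x y : R.obj (op e)), x * x = 0 → x * y = 0 → y * y = 0 →
          (Pi.single k x + Pi.single l y : Fin d → R.obj (op e)) ∈
            firstOrder (R.obj (op e)) d := by
        intro x y hxx hxy hyy i j
        have hyx : y * x = 0 := by rw [mul_comm, hxy]
        simp only [Pi.add_apply, Pi.single_apply]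
        split_ifs <;> simp [mul_add, add_mul, hxx, hxy, hyy, hyx]
      have hv : v ∈ firstOrder (R.obj (op e)) d := hD s t hss hst htt
      have hw : w ∈ firstOrder (R.obj (op e)) d := hD s' t' hs's' hs't' ht't'
      have hvw' : v + w = Pi.single k (s + s') + Pi.single l (t + t') := by
        funext i
        simp only [v, w, Pi.add_apply, Pi.single_apply]
        split_ifs <;> ring
      -- The cross term is `s t' + t s'`, which cancels by the sign convention while `s t'` itself
      -- survives.
      have hvw : v + w ∈ firstOrder (R.obj (op e)) d := by
        rw [hvw']
        exact hD _ _ (by linear_combination hss + 2 * hss' + hs's')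
          (by linear_combination hst + hst' + hts' + hs't')
          (by linear_combination htt + 2 * htt' + ht't')
      have key := hadd f v w hv hw hvw
      rw [expand f hv hw, expand f hvw zero_mem_firstOrder] at key
      simp only [Fintype.sum_option, Option.elim_none, Option.elim_some, Pi.zero_apply, mul_zero,
        mul_one, one_mul, Finset.sum_const_zero, add_zero, Pi.add_apply, mul_add,
        Finset.sum_add_distrib, hlin] at key
      -- The constant and, by `hlin`, the linear terms agree on both sides of `key`; only the
      -- bilinear part is left.
      have key' : ∑ i, ∑ j, scalarRes R f (a ![some i, some j]) * (v i * w j) = 0 := by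
        linear_combination key
      simp only [v, w, Pi.add_apply, Pi.single_apply, add_mul, mul_add, ite_mul, mul_ite, zero_mul,
        mul_zero, Finset.sum_add_distrib, Finset.sum_ite_eq', Finset.mem_univ, if_true,
        hss', htt', hst', hts'] at key'
      rw [weilEval_tmul, map_zero, map_sub]
      linear_combination key'
    have := congrArg ((TensorProduct.rid ℚ _).toLinearMap ∘ₗ
      LinearMap.lTensor _ SkewAlgebra.socleCoord) hzero
    simpa [SkewAlgebra.socleCoord, q, sub_eq_zero] using this
  rw [expand f hv hw, expand f hw hv, Finset.sum_comm]
  refine Finset.sum_congr rfl fun o _ => Finset.sum_congr rfl fun o' _ => ?_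
  rw [mul_comm (o'.elim 1 v)]
  congr 2
  cases o <;> cases o' <;> simp [hlin, hquad]

end Scalars

/-! ### Transport along paths and its relation to grids. -/

section Combinatorics

variable {X : Type*} {r : X → X → Prop} {op : X → X → X → X}

/-- The transport of `z` along the path `y`. -/
def transport (op : X → X → X → X) (y : ℕ → X) (z : X) : ℕ → X
  | 0 => z
  | n + 1 => op (transport op y z n) (y n) (y (n + 1))

/-- `transport` recurses on the last step; the list version `transportSteps` recurses on the first,
so the comparison needs this form. -/
lemma transport_succ_eq (op : X → X → X → X) (y : ℕ → X) (z : X) (n : ℕ) :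
    transport op y z (n + 1) = transport op (fun k => y (k + 1)) (op z (y 0) (y 1)) n := by
  induction n with
  | zero => rfl
  | succ n ih => rw [transport, ih, transport]

lemma grid_succ_eq_transport (op : X → X → X → X) (y z : ℕ → X) (i : ℕ) :
    grid op y z (i + 1) = transport op (grid op y z i) (z (i + 1)) := by
  funext j
  induction j with
  | zero => rw [grid, transport]
  | succ j ih => rw [grid, ih, transport]

namespace IsAffineConnection

lemma rel_transport (h : IsAffineConnection r op) (hr : ∀ x y, r x y → r y x) {x z : X} {n : ℕ}
    {y : ℕ → X} (hy : IsPath r x n y) (hz : r x z) {j : ℕ} (hj : j ≤ n) :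
    r (y j) (transport op y z j) := by
  induction j with
  | zero => rwa [transport, hy.domain]
  | succ j ih => exact hr _ _ (h.nbr_active _ _ _ (hy.step j hj) (ih (by omega)))

lemma isPath_transport (h : IsAffineConnection r op) (hr : ∀ x y, r x y → r y x) {x z : X} {n : ℕ}
    {y : ℕ → X} (hy : IsPath r x n y) (hz : r x z) : IsPath r z n (transport op y z) where
  domain := rfl
  step j hj := hr _ _ (h.nbr_passive _ _ _ (hy.step j hj) (h.rel_transport hr hy hz hj.le))

lemma isPath_grid (h : IsAffineConnection r op) (hr : ∀ x y, r x y → r y x) {x : X} {n m : ℕ}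
    {y z : ℕ → X} (hy : IsPath r x n y) (hz : IsPath r x m z) {i : ℕ} (hi : i ≤ m) :
    IsPath r (z i) n (grid op y z i) := by
  induction i with
  | zero =>
    exact ⟨by rw [grid, hy.domain, hz.domain],
      fun j hj => by simpa only [grid] using hy.step j hj⟩
  | succ i ih =>
    rw [grid_succ_eq_transport]
    exact h.isPath_transport hr (ih (by omega)) (hz.step i hi)

lemma rel_grid_succ (h : IsAffineConnection r op) (hr : ∀ x y, r x y → r y x) {x : X} {n m : ℕ}
    {y z : ℕ → X} (hy : IsPath r x n y) (hz : IsPath r x m z) {i j : ℕ} (hi : i < m) (hj : j ≤ n) :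
    r (grid op y z i j) (grid op y z (i + 1) j) := by
  rw [grid_succ_eq_transport]
  exact h.rel_transport hr (h.isPath_grid hr hy hz hi.le) (hz.step i hi) hj

/-- For a symmetric connection the grid of `y, z` is the transpose of the grid of `z, y`. -/
lemma grid_transpose (h : IsAffineConnection r op) (hr : ∀ x y, r x y → r y x)
    (hsymm : IsTorsionFree r op) {x : X} {n m : ℕ} {y z : ℕ → X} (hy : IsPath r x n y)
    (hz : IsPath r x m z) (i j : ℕ) (hi : i ≤ m) (hj : j ≤ n) :
    grid op y z i j = grid op z y j i := by
  induction i generalizing j with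
  | zero =>
    cases j with
    | zero => rw [grid, grid, hy.domain, hz.domain]
    | succ j => rw [grid, grid]
  | succ i ihi =>
    induction j with
    | zero => rw [grid, grid]
    | succ j ihj =>
      rw [grid, grid, ← ihj (by omega), ← ihi j (by omega) (by omega), ← ihi (j + 1) (by omega) hj]
      exact hsymm _ _ _ ((h.isPath_grid hr hy hz (by omega)).step j hj)
        (h.rel_grid_succ hr hy hz hi (by omega))

end IsAffineConnection

/-- Transport along a path depends only on the end points of the path. -/
def IsPathIndependent (r : X → X → Prop) (op : X → X → X → X) : Prop :=
  ∀ ⦃x z : X⦄ ⦃n n' : ℕ⦄ ⦃y y' : ℕ → X⦄, r x z → IsPath r x n y → IsPath r x n' y' →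
    y n = y' n' → transport op y z n = transport op y' z n'

namespace IsAffineConnection

/-- By induction the two `i`-th rows are paths from `z i` to a common end, and the next rows
transport the same point `z (i + 1)` along them. -/
lemma grid_eq_of_path_eq (h : IsAffineConnection r op) (hr : ∀ x y, r x y → r y x)
    (hind : IsPathIndependent r op) {x : X} {n n' m : ℕ} {y y' z : ℕ → X} (hy : IsPath r x n y)
    (hy' : IsPath r x n' y') (hz : IsPath r x m z) (hyy' : y n = y' n') {i : ℕ} (hi : i ≤ m) :
    grid op y z i n = grid op y' z i n' := by
  induction i with
  | zero => rwa [grid, grid]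
  | succ i ih =>
    rw [grid_succ_eq_transport, grid_succ_eq_transport]
    exact hind (hz.step i hi) (h.isPath_grid hr hy hz (by omega))
      (h.isPath_grid hr hy' hz (by omega)) (ih (by omega))

/-- The corner of a grid depends only on the end points of the two paths. -/
lemma grid_eq (h : IsAffineConnection r op) (hr : ∀ x y, r x y → r y x)
    (hsymm : IsTorsionFree r op) (hind : IsPathIndependent r op) {x : X} {n n' m m' : ℕ}
    {y y' z z' : ℕ → X} (hy : IsPath r x n y) (hz : IsPath r x m z) (hy' : IsPath r x n' y')
    (hz' : IsPath r x m' z') (hyy' : y n = y' n') (hzz' : z m = z' m') :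
    grid op y z m n = grid op y' z' m' n' := by
  rw [h.grid_eq_of_path_eq hr hind hy hy' hz hyy' le_rfl,
    h.grid_transpose hr hsymm hy' hz _ _ le_rfl le_rfl,
    h.grid_eq_of_path_eq hr hind hz hz' hy' hzz' le_rfl,
    h.grid_transpose hr hsymm hy' hz' _ _ le_rfl le_rfl]

/-- It suffices to compare transports along paths of the same length. -/
lemma isPathIndependent_of_same_length (h : IsAffineConnection r op) (hr : ∀ x y, r x y → r y x)
    (hrefl : ∀ x, r x x)
    (hind : ∀ ⦃x z : X⦄ ⦃n : ℕ⦄ ⦃y y' : ℕ → X⦄, r x z → IsPath r x n y → IsPath r x n y' →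
      y n = y' n → transport op y z n = transport op y' z n) : IsPathIndependent r op := by
  have pad : ∀ {x z : X} {n : ℕ} {y : ℕ → X} (N : ℕ), r x z → IsPath r x n y → n ≤ N →
      ∃ Y, IsPath r x N Y ∧ Y N = y n ∧ transport op Y z N = transport op y z n := by
    intro x z n y N hz hy hN
    induction N, hN using Nat.le_induction with
    | base => exact ⟨y, hy, rfl, rfl⟩
    | succ N hN ih =>
      obtain ⟨Y, hY, hYN, hT⟩ := ih
      -- The last point is repeated; by the law `[zxx] = z` the extra step does not move the
      -- transported point.
      refine ⟨fun k => Y (min k N), ⟨by simpa using hY.domain, fun i hi => ?_⟩, by simpa, ?_⟩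
      · obtain hi | rfl := (Nat.lt_succ_iff.1 hi).lt_or_eq
        · simp only [min_eq_left hi.le, min_eq_left (Nat.succ_le_of_lt hi)]
          exact hY.step i hi
        · simpa using hrefl _
      · have : ∀ k ≤ N, transport op (fun k => Y (min k N)) z k = transport op Y z k := by
          intro k hk
          induction k with
          | zero => rfl
          | succ k ihk =>
            rw [transport, transport, ihk (by omega), min_eq_left hk, min_eq_left (by omega)]
        rw [transport, this N le_rfl, min_self, min_eq_right (by omega), h.unit_left, hT]
        exact h.rel_transport hr hY hz le_rfl
  intro x z n n' y y' hz hy hy' he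
  obtain ⟨Y, hY, hYN, hT⟩ := pad (max n n') hz hy (le_max_left _ _)
  obtain ⟨Y', hY', hYN', hT'⟩ := pad (max n n') hz hy' (le_max_right _ _)
  rw [← hT, ← hT']
  exact hind hz hY hY' (by rw [hYN, hYN', he])

end IsAffineConnection

end Combinatorics

/-! ### Locality, coordinates and neighbours in a formal manifold. -/

variable {C : Type u} [Category.{v} C] {J : GrothendieckTopology C}

/-- Sections of a sheaf of algebras that agree locally are equal. -/
lemma scalar_ext (R : Sheaf J (CommAlgCat.{w₁} ℚ)) {c : C} {a b : R.obj.obj (op c)} {S : Sieve c}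
    (hS : S ∈ J c)
    (h : ∀ (d : C) (f : d ⟶ c), S f → scalarRes R.obj f a = scalarRes R.obj f b) : a = b := by
  -- The sheaf condition speaks of maps out of test algebras; maps out of the free algebra on one
  -- generator are the elements.
  let E : CommAlgCat.{w₁} ℚ := CommAlgCat.of ℚ (ULift.{w₁} (Polynomial ℚ))
  let φ : R.obj.obj (op c) → (E ⟶ R.obj.obj (op c)) := fun a =>
    CommAlgCat.ofHom ((Polynomial.aeval a).comp ULift.algEquiv.toAlgHom)
  have hφ : φ a = φ b := by
    refine ((R.property E).isSeparated S hS).ext fun d f hf => ?_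
    apply CommAlgCat.hom_ext
    have : ((R.obj.map f.op).hom.comp (Polynomial.aeval a)) =
        (R.obj.map f.op).hom.comp (Polynomial.aeval b) := by
      apply Polynomial.algHom_ext
      simpa using h d f hf
    exact congrArg (fun ψ => AlgHom.comp ψ (ULift.algEquiv (R := ℚ) (A := Polynomial ℚ)).toAlgHom)
      this
  have hX : ∀ a, (φ a).hom (ULift.up Polynomial.X) = a := fun a => Polynomial.aeval_X a
  rw [← hX a, hφ, hX]

namespace FormalManifold

variable {R : Sheaf J (CommAlgCat.{w₁} ℚ)} {n : ℕ} (M : FormalManifold.{t, w₂} R n)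

lemma pt_ext {c : C} {p q : M.Pt c} {S : Sieve c} (hS : S ∈ J c)
    (h : ∀ (d : C) (f : d ⟶ c), S f → M.res f p = M.res f q) : p = q :=
  (((isSheaf_iff_isSheaf_of_type J M.carrier.obj).1 M.carrier.property).isSeparated S hS).ext
    fun d f hf => h d f hf

lemma res_comp {c d e : C} (f : d ⟶ c) (g : e ⟶ d) (p : M.Pt c) :
    M.res (g ≫ f) p = M.res g (M.res f p) := by
  simp [res]

lemma res_id {c : C} (p : M.Pt c) : M.res (𝟙 c) p = p := by
  simp [res]

lemma res_mem (i : M.ι) {c d : C} (f : d ⟶ c) {p : M.Pt c} (hp : p ∈ (M.dom i).obj (op c)) :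
    M.res f p ∈ (M.dom i).obj (op d) :=
  (M.dom i).map f.op hp

open Classical in
/-- The coordinates of a point in a chart, with value `0` outside of the chart domain. -/
noncomputable def coord (i : M.ι) {c : C} (p : M.Pt c) : Fin n → R.obj.obj (op c) :=
  if hp : p ∈ (M.dom i).obj (op c) then M.chart i ⟨p, hp⟩ else 0

variable {M}

lemma coord_of_mem {i : M.ι} {c : C} {p : M.Pt c} (hp : p ∈ (M.dom i).obj (op c)) :
    M.coord i p = M.chart i ⟨p, hp⟩ :=
  dif_pos hp

lemma coord_res {i : M.ι} {c d : C} (f : d ⟶ c) {p : M.Pt c} (hp : p ∈ (M.dom i).obj (op c)) :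
    M.coord i (M.res f p) = scalarRes R.obj f ∘ M.coord i p := by
  rw [coord_of_mem hp, coord_of_mem (M.res_mem i f hp)]
  exact funext fun k => M.chart_natural i f ⟨p, hp⟩ k

lemma coord_injective {i : M.ι} {c : C} {p q : M.Pt c} (hp : p ∈ (M.dom i).obj (op c))
    (hq : q ∈ (M.dom i).obj (op c)) (h : M.coord i p = M.coord i q) : p = q := by
  rw [coord_of_mem hp, coord_of_mem hq] at h
  exact congrArg Subtype.val (M.chart_injective i c h)

lemma exists_coord_eq_add {i : M.ι} {c : C} {p : M.Pt c} (hp : p ∈ (M.dom i).obj (op c))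
    {v : Fin n → R.obj.obj (op c)} (hv : v ∈ firstOrder (R.obj.obj (op c)) n) :
    ∃ q ∈ (M.dom i).obj (op c), M.coord i q = M.coord i p + v := by
  obtain ⟨⟨q, hq⟩, h⟩ := M.chart_open i ⟨p, hp⟩ v hv
  exact ⟨q, hq, by rw [coord_of_mem hq, coord_of_mem hp, h]⟩

variable (M) in
open Classical in
/-- The point obtained from `p` by adding `v` to its coordinates, if it exists. -/
noncomputable def shift (i : M.ι) {c : C} (p : M.Pt c) (v : Fin n → R.obj.obj (op c)) : M.Pt c :=
  if h : ∃ q ∈ (M.dom i).obj (op c), M.coord i q = M.coord i p + v then h.choose else p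

section Shift

variable {i : M.ι} {c : C} {p : M.Pt c} {v : Fin n → R.obj.obj (op c)}

lemma shift_mem (hp : p ∈ (M.dom i).obj (op c)) (hv : v ∈ firstOrder (R.obj.obj (op c)) n) :
    M.shift i p v ∈ (M.dom i).obj (op c) := by
  rw [shift, dif_pos (exists_coord_eq_add hp hv)]
  exact (exists_coord_eq_add hp hv).choose_spec.1

lemma coord_shift (hp : p ∈ (M.dom i).obj (op c)) (hv : v ∈ firstOrder (R.obj.obj (op c)) n) :
    M.coord i (M.shift i p v) = M.coord i p + v := by
  rw [shift, dif_pos (exists_coord_eq_add hp hv)]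
  exact (exists_coord_eq_add hp hv).choose_spec.2

lemma shift_eq {q : M.Pt c} (hp : p ∈ (M.dom i).obj (op c)) (hq : q ∈ (M.dom i).obj (op c))
    (hv : v ∈ firstOrder (R.obj.obj (op c)) n) (h : M.coord i q = M.coord i p + v) :
    M.shift i p v = q :=
  coord_injective (shift_mem hp hv) hq (by rw [coord_shift hp hv, h])

lemma res_shift {d : C} (f : d ⟶ c) (hp : p ∈ (M.dom i).obj (op c))
    (hv : v ∈ firstOrder (R.obj.obj (op c)) n) :
    M.res f (M.shift i p v) = M.shift i (M.res f p) (scalarRes R.obj f ∘ v) := by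
  refine (shift_eq (M.res_mem i f hp) (M.res_mem i f (shift_mem hp hv)) (firstOrder_map _ hv)
    ?_).symm
  rw [coord_res f (shift_mem hp hv), coord_shift hp hv, coord_res f hp]
  funext k
  simp

end Shift

/-- The neighbour relation in a chart does not depend on the chart. -/
lemma coord_sub_mem_firstOrder (hR : KockLawvere R.obj) {i j : M.ι} {c : C} {p q : M.Pt c}
    (hp : p ∈ (M.dom j).obj (op c)) (hq : q ∈ (M.dom j).obj (op c))
    (h : M.coord j q - M.coord j p ∈ firstOrder (R.obj.obj (op c)) n)
    (hpi : p ∈ (M.dom i).obj (op c)) :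
    q ∈ (M.dom i).obj (op c) ∧
      M.coord i q - M.coord i p ∈ firstOrder (R.obj.obj (op c)) n := by
  have hopen : ∀ {e : C} {p q : M.Pt e}, p ∈ (M.dom j).obj (op e) → q ∈ (M.dom j).obj (op e) →
      M.coord j q - M.coord j p ∈ firstOrder (R.obj.obj (op e)) n →
      p ∈ (M.dom i).obj (op e) → q ∈ (M.dom i).obj (op e) := by
    intro e p q hp hq h hpi
    rw [coord_of_mem hp, coord_of_mem hq] at h
    exact M.dom_open i j ⟨p, hp⟩ ⟨q, hq⟩ h hpi
  refine ⟨hopen hp hq h hpi, ?_⟩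
  have hshift : ∀ {e : C} (f : e ⟶ c) {v : Fin n → R.obj.obj (op e)},
      v ∈ firstOrder (R.obj.obj (op e)) n →
      M.shift j (M.res f p) v ∈ (M.dom i).obj (op e) := fun f v hv =>
    hopen (M.res_mem j f hp) (shift_mem (M.res_mem j f hp) hv)
      (by rwa [coord_shift (M.res_mem j f hp) hv, add_sub_cancel_left]) (M.res_mem i f hpi)
  -- On the monad of `p` the change of charts is affine, so differences of coordinates transform
  -- linearly, and linear maps preserve `D(n)`.
  choose a ha _ using fun k => hR.existsUnique_affine
    (fun e (f : e ⟶ c) v => M.coord i (M.shift j (M.res f p) v) k) (by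
      intro e e' f g v hv
      simp only [res_comp]
      rw [← res_shift g (M.res_mem j f hp) hv, coord_res g (hshift f hv)]
      rfl)
  have key : ∀ v ∈ firstOrder (R.obj.obj (op c)) n, ∀ k,
      M.coord i (M.shift j p v) k = a k none + ∑ l, a k (some l) * v l := by
    intro v hv k
    have := ha k c (𝟙 c) v hv
    simpa only [res_id, Fintype.sum_option, scalarRes_id, Option.elim_none, Option.elim_some,
      mul_one] using this
  have hq' : M.shift j p (M.coord j q - M.coord j p) = q := shift_eq hp hq h (by simp)
  have hp' : M.shift j p 0 = p := shift_eq hp hp zero_mem_firstOrder (by simp)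
  have hdiff : ∀ k, (M.coord i q - M.coord i p) k =
      ∑ l, a k (some l) * (M.coord j q - M.coord j p) l := by
    intro k
    have h1 := key _ h k
    have h2 := key 0 zero_mem_firstOrder k
    rw [hq'] at h1
    rw [hp'] at h2
    rw [Pi.sub_apply, h1, h2]
    simp
  intro k l
  rw [hdiff, hdiff, Finset.sum_mul_sum]
  refine Finset.sum_eq_zero fun s _ => Finset.sum_eq_zero fun s' _ => ?_
  rw [mul_mul_mul_comm, h s s', mul_zero]

lemma chartNbr_iff {c : C} {p q : M.Pt c} : M.ChartNbr p q ↔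
    ∃ i, p ∈ (M.dom i).obj (op c) ∧ q ∈ (M.dom i).obj (op c) ∧
      M.coord i q - M.coord i p ∈ firstOrder (R.obj.obj (op c)) n := by
  refine exists_congr fun i => ⟨?_, ?_⟩
  · rintro ⟨hp, hq, h⟩
    exact ⟨hp, hq, by rwa [coord_of_mem hp, coord_of_mem hq]⟩
  · rintro ⟨hp, hq, h⟩
    exact ⟨hp, hq, by rwa [coord_of_mem hp, coord_of_mem hq] at h⟩

/-- The neighbours of a point of a chart domain, in coordinates. -/
lemma nbr_iff (hR : KockLawvere R.obj) {i : M.ι} {c : C} {p q : M.Pt c}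
    (hp : p ∈ (M.dom i).obj (op c)) :
    M.Nbr c p q ↔ q ∈ (M.dom i).obj (op c) ∧
      M.coord i q - M.coord i p ∈ firstOrder (R.obj.obj (op c)) n := by
  constructor
  · rintro ⟨S, hS, h⟩
    have hloc : ∀ (d : C) (f : d ⟶ c), S f → M.res f q ∈ (M.dom i).obj (op d) ∧
        M.coord i (M.res f q) - M.coord i (M.res f p) ∈ firstOrder (R.obj.obj (op d)) n := by
      intro d f hf
      obtain ⟨j, hpj, hqj, hj⟩ := chartNbr_iff.1 (h d f hf)
      exact coord_sub_mem_firstOrder hR hpj hqj hj (M.res_mem i f hp)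
    have hq : q ∈ (M.dom i).obj (op c) := M.dom_local i c q
      (J.superset_covering (fun d f hf => (hloc d f hf).1) hS)
    refine ⟨hq, fun k l => scalar_ext R hS fun d f hf => ?_⟩
    have := (hloc d f hf).2 k l
    rw [coord_res f hq, coord_res f hp] at this
    simpa using this
  · rintro ⟨hq, h⟩
    refine ⟨⊤, J.top_mem c, fun d f _ => chartNbr_iff.2
      ⟨i, M.res_mem i f hp, M.res_mem i f hq, ?_⟩⟩
    rw [coord_res f hq, coord_res f hp]
    convert firstOrder_map (scalarRes R.obj f) h using 1
    funext k
    simp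

lemma Nbr.symm {c : C} {p q : M.Pt c} (h : M.Nbr c p q) : M.Nbr c q p := by
  obtain ⟨S, hS, h⟩ := h
  refine ⟨S, hS, fun d f hf => ?_⟩
  obtain ⟨i, hp, hq, h⟩ := h d f hf
  refine ⟨i, hq, hp, fun k l => ?_⟩
  have := h k l
  simp only [Pi.sub_apply] at this ⊢
  linear_combination this

lemma Nbr.refl {c : C} (p : M.Pt c) : M.Nbr c p p := by
  obtain ⟨S, hS, h⟩ := M.cover c p
  refine ⟨S, hS, fun d f hf => ?_⟩
  obtain ⟨i, hi⟩ := h d f hf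
  exact ⟨i, hi, hi, fun k l => by simp⟩

lemma Nbr.res {c d : C} (f : d ⟶ c) {p q : M.Pt c} (h : M.Nbr c p q) :
    M.Nbr d (M.res f p) (M.res f q) := by
  obtain ⟨S, hS, h⟩ := h
  refine ⟨S.pullback f, J.pullback_stable f hS, fun e g hg => ?_⟩
  rw [← res_comp, ← res_comp]
  exact h e (g ≫ f) hg

lemma nbr_shift (hR : KockLawvere R.obj) {i : M.ι} {c : C} {p : M.Pt c}
    {v : Fin n → R.obj.obj (op c)} (hp : p ∈ (M.dom i).obj (op c))
    (hv : v ∈ firstOrder (R.obj.obj (op c)) n) : M.Nbr c p (M.shift i p v) :=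
  (nbr_iff hR hp).2 ⟨shift_mem hp hv, by rwa [coord_shift hp hv, add_sub_cancel_left]⟩

/-! ### Transport in a chart and path independence. -/

namespace AffineConnection

variable (Λ : M.AffineConnection)

/-- Transport of `z` from `p` along the path with given consecutive differences in a chart. -/
noncomputable def transportSteps (i : M.ι) {c : C} :
    M.Pt c → M.Pt c → List (Fin n → R.obj.obj (op c)) → M.Pt c
  | _, z, [] => z
  | p, z, v :: l => transportSteps i (M.shift i p v) (Λ.bracket c z p (M.shift i p v)) l

variable {Λ} {i : M.ι} {c : C}

lemma nbr_bracket_shift (hR : KockLawvere R.obj) {p z : M.Pt c} {v : Fin n → R.obj.obj (op c)}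
    (hp : p ∈ (M.dom i).obj (op c)) (hz : M.Nbr c p z)
    (hv : v ∈ firstOrder (R.obj.obj (op c)) n) :
    M.Nbr c (M.shift i p v) (Λ.bracket c z p (M.shift i p v)) :=
  ((Λ.laws c).nbr_active _ _ _ (nbr_shift hR hp hv) hz).symm

lemma transportSteps_mem (hR : KockLawvere R.obj) {p z : M.Pt c}
    {l : List (Fin n → R.obj.obj (op c))} (hp : p ∈ (M.dom i).obj (op c)) (hz : M.Nbr c p z)
    (hl : ∀ v ∈ l, v ∈ firstOrder (R.obj.obj (op c)) n) :
    Λ.transportSteps i p z l ∈ (M.dom i).obj (op c) := by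
  induction l generalizing p z with
  | nil => exact ((nbr_iff hR hp).1 hz).1
  | cons v l ih =>
    rw [List.forall_mem_cons] at hl
    exact ih (shift_mem hp hl.1) (nbr_bracket_shift hR hp hz hl.1) hl.2

lemma res_transportSteps (hR : KockLawvere R.obj) {d : C} (f : d ⟶ c) {p z : M.Pt c}
    {l : List (Fin n → R.obj.obj (op c))} (hp : p ∈ (M.dom i).obj (op c)) (hz : M.Nbr c p z)
    (hl : ∀ v ∈ l, v ∈ firstOrder (R.obj.obj (op c)) n) :
    M.res f (Λ.transportSteps i p z l) = Λ.transportSteps i (M.res f p) (M.res f z)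
      (l.map fun v => scalarRes R.obj f ∘ v) := by
  induction l generalizing p z with
  | nil => rfl
  | cons v l ih =>
    rw [List.forall_mem_cons] at hl
    rw [transportSteps, ih (shift_mem hp hl.1) (nbr_bracket_shift hR hp hz hl.1) hl.2,
      List.map_cons, transportSteps, Λ.natural f _ _ _ (nbr_shift hR hp hl.1) hz,
      res_shift f hp hl.1]

/-- When `v + w` is in `D(n)`, flatness merges the two steps into one; `symmetric_of_add` extends
the resulting symmetry to all `v, w`. -/
lemma transportSteps_swap (hR : KockLawvere R.obj) (hflat : Λ.Flat) {p z : M.Pt c}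
    {v w : Fin n → R.obj.obj (op c)} (hp : p ∈ (M.dom i).obj (op c)) (hz : M.Nbr c p z)
    (hv : v ∈ firstOrder (R.obj.obj (op c)) n) (hw : w ∈ firstOrder (R.obj.obj (op c)) n) :
    Λ.transportSteps i p z [v, w] = Λ.transportSteps i p z [w, v] := by
  have hpair : ∀ {e : C} {v w : Fin n → R.obj.obj (op e)}, v ∈ firstOrder (R.obj.obj (op e)) n →
      w ∈ firstOrder (R.obj.obj (op e)) n → ∀ u ∈ [v, w], u ∈ firstOrder (R.obj.obj (op e)) n := by
    intro e v w hv hw u hu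
    simp only [List.mem_cons, List.not_mem_nil, or_false] at hu
    obtain rfl | rfl := hu <;> assumption
  refine coord_injective (transportSteps_mem hR hp hz (hpair hv hw))
    (transportSteps_mem hR hp hz (hpair hw hv)) (funext fun k => ?_)
  have := hR.symmetric_of_add (fun e (f : e ⟶ c) v w =>
    M.coord i (Λ.transportSteps i (M.res f p) (M.res f z) [v, w]) k) ?_ ?_ (𝟙 c) hv hw
  · simpa only [res_id] using this
  · intro e e' f g v w hv hw
    have hp' := M.res_mem i f hp
    have hz' := hz.res f
    have := coord_res g (transportSteps_mem (Λ := Λ) hR hp' hz' (hpair hv hw))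
    rw [res_transportSteps hR g hp' hz' (hpair hv hw)] at this
    simp only [res_comp]
    exact congrFun this k
  · intro e f v w hv hw hvw
    have hp' := M.res_mem i f hp
    have hz' := hz.res f
    have h1 : M.shift i (M.shift i (M.res f p) v) w = M.shift i (M.res f p) (v + w) :=
      shift_eq (shift_mem hp' hv) (shift_mem hp' hvw) hw
        (by rw [coord_shift hp' hvw, coord_shift hp' hv, add_assoc])
    -- The zero step only gives the merged transport the two-step shape; the unit law removes it.
    have h2 : M.shift i (M.shift i (M.res f p) (v + w)) 0 = M.shift i (M.res f p) (v + w) :=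
      shift_eq (shift_mem hp' hvw) (shift_mem hp' hvw) zero_mem_firstOrder (by simp)
    simp only [transportSteps, h1, h2]
    rw [hflat e _ _ _ (nbr_shift hR hp' hv) (h1 ▸ nbr_shift hR (shift_mem hp' hv) hw)
      (nbr_shift hR hp' hvw) _ hz', (Λ.laws e).unit_left _ _ (nbr_bracket_shift hR hp' hz' hvw)]

/-- Adjacent swaps suffice: the two orders lead to the same transported point and, as coordinates
add commutatively, to the same base point for the remaining steps. -/
lemma transportSteps_perm (hR : KockLawvere R.obj) (hflat : Λ.Flat) {p z : M.Pt c}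
    {l l' : List (Fin n → R.obj.obj (op c))} (hp : p ∈ (M.dom i).obj (op c)) (hz : M.Nbr c p z)
    (hl : ∀ v ∈ l, v ∈ firstOrder (R.obj.obj (op c)) n) (h : l.Perm l') :
    Λ.transportSteps i p z l = Λ.transportSteps i p z l' := by
  induction h generalizing p z with
  | nil => rfl
  | cons v h ih =>
    rw [List.forall_mem_cons] at hl
    exact ih (shift_mem hp hl.1) (nbr_bracket_shift hR hp hz hl.1) hl.2
  | swap v w l =>
    rw [List.forall_mem_cons, List.forall_mem_cons] at hl
    obtain ⟨hw, hv, -⟩ := hl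
    have h1 : M.shift i (M.shift i p w) v = M.shift i (M.shift i p v) w :=
      shift_eq (shift_mem hp hw) (shift_mem (shift_mem hp hv) hw) hv
        (by rw [coord_shift (shift_mem hp hv) hw, coord_shift hp hv, coord_shift hp hw,
          add_right_comm])
    have h2 := transportSteps_swap hR hflat hp hz hw hv
    simp only [transportSteps] at h2 ⊢
    rw [h2, h1]
  | trans h h' ih ih' =>
    exact (ih hp hz hl).trans (ih' hp hz fun v hv => hl v (h.mem_iff.2 hv))

/-- Transport along a path in a chart depends only on the sum of the steps. -/
lemma transportSteps_eq_of_sum_eq (hR : KockLawvere R.obj) (hflat : Λ.Flat) {p z : M.Pt c} {N : ℕ}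
    {v v' : Fin N → Fin n → R.obj.obj (op c)} (hp : p ∈ (M.dom i).obj (op c)) (hz : M.Nbr c p z)
    (hv : ∀ k, v k ∈ firstOrder (R.obj.obj (op c)) n)
    (hv' : ∀ k, v' k ∈ firstOrder (R.obj.obj (op c)) n) (hsum : ∑ k, v k = ∑ k, v' k) :
    Λ.transportSteps i p z (List.ofFn v) = Λ.transportSteps i p z (List.ofFn v') := by
  have hlist : ∀ {e : C} {v : Fin N → Fin n → R.obj.obj (op e)},
      (∀ k, v k ∈ firstOrder (R.obj.obj (op e)) n) →
      ∀ u ∈ List.ofFn v, u ∈ firstOrder (R.obj.obj (op e)) n := by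
    intro e v hv u hu
    obtain ⟨k, rfl⟩ := List.mem_ofFn.1 hu
    exact hv k
  refine coord_injective (transportSteps_mem hR hp hz (hlist hv))
    (transportSteps_mem hR hp hz (hlist hv')) (funext fun k => ?_)
  obtain ⟨a, ha, hua⟩ := hR.existsUnique_multiaffine N (c := c) (fun e (f : e ⟶ c) v =>
    M.coord i (Λ.transportSteps i (M.res f p) (M.res f z) (List.ofFn v)) k) (by
      intro e e' f g v hv
      have hp' := M.res_mem i f hp
      have hz' := hz.res f
      have := coord_res g (transportSteps_mem (Λ := Λ) hR hp' hz' (hlist hv))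
      rw [res_transportSteps hR g hp' hz' (hlist hv), List.map_ofFn] at this
      simp only [res_comp]
      exact congrFun this k)
  -- The permuted coefficients represent the same function, so uniqueness identifies them with `a`.
  have hsymm : ∀ (σ : Equiv.Perm (Fin N)) s, a (s ∘ σ) = a s := by
    intro σ
    refine congrFun (hua (fun s => a (s ∘ σ)) fun e f v hv => ?_)
    have hperm : Λ.transportSteps i (M.res f p) (M.res f z) (List.ofFn v) =
        Λ.transportSteps i (M.res f p) (M.res f z) (List.ofFn (v ∘ σ)) :=
      transportSteps_perm hR hflat (M.res_mem i f hp) (hz.res f) (hlist hv)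
        (Equiv.Perm.ofFn_comp_perm σ v).symm
    simp only
    rw [hperm, ha e f (v ∘ σ) fun k => hv _, ← (σ.symm.arrowCongr (Equiv.refl _)).sum_comp]
    refine Finset.sum_congr rfl fun s _ => ?_
    exact congrArg _ (Equiv.prod_comp σ fun k => (s k).elim 1 (v k))
  have expand : ∀ v : Fin N → Fin n → R.obj.obj (op c),
      (∀ k, v k ∈ firstOrder (R.obj.obj (op c)) n) →
      M.coord i (Λ.transportSteps i p z (List.ofFn v)) k = ∑ s, a s * ∏ j, (s j).elim 1 (v j) := by
    intro v hv
    have := ha c (𝟙 c) v hv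
    simpa only [res_id, scalarRes_id] using this
  rw [expand v hv, expand v' hv']
  exact symmetric_multiaffine_eq a hsymm hv hv' hsum

/-- Closure of chart domains under neighbours propagates along the path, so no change of chart is
ever needed. -/
lemma mem_of_isPath (hR : KockLawvere R.obj) {x : M.Pt c} {N : ℕ} {y : ℕ → M.Pt c}
    (hx : x ∈ (M.dom i).obj (op c)) (hy : IsPath (M.Nbr c) x N y) {k : ℕ} (hk : k ≤ N) :
    y k ∈ (M.dom i).obj (op c) := by
  induction k with
  | zero => rwa [hy.domain]
  | succ k ih => exact ((nbr_iff hR (ih (by omega))).1 (hy.step k hk)).1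

lemma transport_eq_transportSteps (hR : KockLawvere R.obj) {x z : M.Pt c} {N : ℕ} {y : ℕ → M.Pt c}
    (hx : x ∈ (M.dom i).obj (op c)) (hy : IsPath (M.Nbr c) x N y) :
    transport (Λ.bracket c) y z N = Λ.transportSteps i x z
      (List.ofFn fun k : Fin N => M.coord i (y (k + 1)) - M.coord i (y k)) := by
  induction N generalizing x y z with
  | zero => simp [transport, transportSteps]
  | succ N ih =>
    have h1 := (nbr_iff hR hx).1 (hy.domain ▸ hy.step 0 N.succ_pos)
    have hshift : M.shift i x (M.coord i (y 1) - M.coord i x) = y 1 :=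
      shift_eq hx h1.1 h1.2 (by simp)
    rw [transport_succ_eq, ih h1.1 ⟨rfl, fun k hk => hy.step (k + 1) (by omega)⟩, List.ofFn_succ,
      transportSteps]
    simp [hy.domain, hshift]

/-- Path independence for paths of the same length in a chart. -/
lemma transport_eq_of_mem (hR : KockLawvere R.obj) (hflat : Λ.Flat) {x z : M.Pt c} {N : ℕ}
    {y y' : ℕ → M.Pt c} (hx : x ∈ (M.dom i).obj (op c)) (hz : M.Nbr c x z)
    (hy : IsPath (M.Nbr c) x N y) (hy' : IsPath (M.Nbr c) x N y') (h : y N = y' N) :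
    transport (Λ.bracket c) y z N = transport (Λ.bracket c) y' z N := by
  rw [transport_eq_transportSteps hR hx hy, transport_eq_transportSteps hR hx hy']
  have hstep : ∀ {y : ℕ → M.Pt c}, IsPath (M.Nbr c) x N y → ∀ k : Fin N,
      M.coord i (y (k + 1)) - M.coord i (y k) ∈ firstOrder (R.obj.obj (op c)) n :=
    fun hy k => ((nbr_iff hR (mem_of_isPath hR hx hy k.2.le)).1 (hy.step k k.2)).2
  refine transportSteps_eq_of_sum_eq hR hflat hx hz (hstep hy) (hstep hy') ?_
  -- The steps telescope to the difference of the end points.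
  rw [Fin.sum_univ_eq_sum_range (fun k => M.coord i (y (k + 1)) - M.coord i (y k)),
    Fin.sum_univ_eq_sum_range (fun k => M.coord i (y' (k + 1)) - M.coord i (y' k)),
    Finset.sum_range_sub (fun k => M.coord i (y k)),
    Finset.sum_range_sub (fun k => M.coord i (y' k)),
    h, hy.domain, hy'.domain]

lemma isPath_res {d : C} (f : d ⟶ c) {x : M.Pt c} {N : ℕ} {y : ℕ → M.Pt c}
    (hy : IsPath (M.Nbr c) x N y) : IsPath (M.Nbr d) (M.res f x) N (fun k => M.res f (y k)) :=
  ⟨congrArg _ hy.domain, fun k hk => (hy.step k hk).res f⟩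

lemma res_transport {d : C} (f : d ⟶ c) {x z : M.Pt c} {N : ℕ} {y : ℕ → M.Pt c}
    (hy : IsPath (M.Nbr c) x N y) (hz : M.Nbr c x z) {k : ℕ} (hk : k ≤ N) :
    M.res f (transport (Λ.bracket c) y z k) =
      transport (Λ.bracket d) (fun k => M.res f (y k)) (M.res f z) k := by
  induction k with
  | zero => rfl
  | succ k ih =>
    rw [transport, transport, ← ih (by omega)]
    exact Λ.natural f _ _ _ (hy.step k hk)
      ((Λ.laws c).rel_transport (fun _ _ => Nbr.symm) hy hz (by omega))

/-- Transport for a flat connection on a formal manifold is path independent. -/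
lemma isPathIndependent (hR : KockLawvere R.obj) (hflat : Λ.Flat) (c : C) :
    IsPathIndependent (M.Nbr c) (Λ.bracket c) := by
  refine (Λ.laws c).isPathIndependent_of_same_length (fun _ _ => Nbr.symm) Nbr.refl ?_
  intro x z N y y' hz hy hy' h
  -- Only the starting point has to be covered by charts: the rest of both paths then follows it.
  obtain ⟨S, hS, hcover⟩ := M.cover c x
  refine M.pt_ext hS fun d f hf => ?_
  obtain ⟨i, hi⟩ := hcover d f hf
  rw [res_transport f hy hz le_rfl, res_transport f hy' hz le_rfl]
  exact transport_eq_of_mem hR hflat hi (hz.res f) (isPath_res f hy) (isPath_res f hy')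
    (congrArg _ h)

end AffineConnection

end FormalManifold

end SDG

theorem proposition3p1 {C : Type u} [Category.{v} C] (J : GrothendieckTopology C)
    (R : Sheaf J (CommAlgCat.{w₁} ℚ)) (hR : SDG.KockLawvere R.obj) (dim : ℕ)
    (M : SDG.FormalManifold.{t, w₂} R dim) (Λ : M.AffineConnection)
    (hsymm : Λ.Symmetric) (hflat : Λ.Flat)
    (c : C) (x : M.Pt c) (n m n' m' : ℕ) (y z y' z' : ℕ → M.Pt c)
    (hy : SDG.IsPath (M.Nbr c) x n y) (hz : SDG.IsPath (M.Nbr c) x m z)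
    (hy' : SDG.IsPath (M.Nbr c) x n' y') (hz' : SDG.IsPath (M.Nbr c) x m' z')
    (hyy' : y n = y' n') (hzz' : z m = z' m') :
    SDG.grid (Λ.bracket c) y z m n = SDG.grid (Λ.bracket c) y' z' m' n' := by
  exact (Λ.laws c).grid_eq (fun _ _ => SDG.FormalManifold.Nbr.symm) (hsymm c)
    (SDG.FormalManifold.AffineConnection.isPathIndependent hR hflat c) hy hz hy' hz' hyy' hzz'
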